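/- A sleeping competing bandit problem with horizon $T$ has players $p_1,\dots,p_N$ and arms $a_1,\dots,a_K$, $N\le K$. At the beginning of each round $t\le T$ the platform is told the set of available players, the set of available arms, the strict preference ranking of each available arm over the available players, and the capacities of the arms, all of which may change from round to round. It chooses a matching of available players to available arms that respects the capacities, and each matched player $p_i$ receives an independent Bernoulli reward, with a mean $\mu_{i,j}\in(0,1)$ that depends only on the player and on the arm $a_j$ matched to it and is unknown to the platform; unmatched players receive $0$. For every player, distinct arms available in the same round have distinct means, so that the means are the players' preferences. A policy is a possibly randomized rule that chooses the matching of each round from $N$, $K$, $T$, the information on the current round, and everything observed in the past rounds. Let $T_i$ be the number of rounds in which $p_i$ is available. The player-optimal (player-pessimal) stable regret $\overline R_i(T_i)$ ($\underline R_i(T_i)$) is the sum, over the rounds in which $p_i$ is available, of the mean reward of $p_i$ in the player-optimal (player-pessimal) stable matching of the round minus the expected reward of $p_i$. **Theorem.** (a) For every policy and every constant $c\in(0,1)$ there are a fixed collection of reward means $(\mu_{i,j})_{i,j\in\mathbb N}$, a number $\Delta>0$ and, for every horizon $T$, an environment (numbers $N_T\le K_T$ of players and arms, availabilities, rankings, capacities)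 in which, for every player, the means of any two arms available in the same round differ by at least $\Delta$, and a player $p_{i}$, $i=i_T$, such that, as $T\to\infty$, $T_i\to\infty$ and $$\overline R_i(T_i)\ \ge\ \underline R_i(T_i)\ =\ \omega(T_i^{\,c}).$$ Moreover the environments can be chosen of the following form, with block lengths $L_T=\Theta(T^{1-c})$: the same two arms, of capacity one, are the available arms of every round; one target player is available in every round, and in each block of $L_T$ consecutive rounds (the last block may be shorter) exactly one other player, a new one for each block, is available; both arms prefer that competitor to the target player. (b) Consequently no policy is $\alpha$-consistent for any $\alpha\in[0,1)$. Here a policy is $\alpha$-consistent if, for every fixed collection of reward means, every $\Delta>0$, every choice of an environment for each horizon $T$ with gaps at least $\Delta$ as in (a), every choice of players $p_{i_T}$ with $T_{i_T}\to\infty$ as $T\to\infty$, and every $c>\alpha$, the player-optimal or the player-pessimal regret of $p_{i_T}$ is bounded above by $o(T_{i_T}^{\,c})$. -/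

import Mathlib

open Filter Asymptotics

namespace SleepingBandit

/-- Everything the platform is told at the beginning of a round, with players `Fin N` and arms
`Fin K`: the available players, the available arms, the preference ranking of every available arm
over the available players (`prefers j i i'` : arm `j` strictly prefers player `i` to player `i'`)
and the capacities. -/
structure RoundInfo (N K : ℕ) where
  players : Finset (Fin N)
  arms : Finset (Fin K)
  prefers : Fin K → Fin N → Fin N → Prop
  cap : Fin K → ℕ
  prefers_irrefl : ∀ j ∈ arms, ∀ i ∈ players, ¬ prefers j i i
  prefers_trans : ∀ j ∈ arms, ∀ i ∈ players, ∀ i' ∈ players, ∀ i'' ∈ players,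
    prefers j i i' → prefers j i' i'' → prefers j i i''
  prefers_total : ∀ j ∈ arms, ∀ i ∈ players, ∀ i' ∈ players,
    i ≠ i' → prefers j i i' ∨ prefers j i' i

/-- An assignment of players to arms; `none` means that the player is unmatched. -/
abbrev Assignment (N K : ℕ) : Type := Fin N → Option (Fin K)

/-- The set of players matched to arm `j`. -/
def Assignment.matched {N K : ℕ} (m : Assignment N K) (j : Fin K) : Finset (Fin N) :=
  Finset.univ.filter fun i => m i = some j

/-- `m` is a matching at the round: only available players are matched, only to available arms,
and the capacities are respected. -/
structure RoundInfo.IsMatching {N K : ℕ} (I : RoundInfo N K) (m : Assignment N K) : Prop where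
  player_mem : ∀ i, i ∉ I.players → m i = none
  arm_mem : ∀ i j, m i = some j → j ∈ I.arms
  card_le : ∀ j ∈ I.arms, (m.matched j).card ≤ I.cap j

/-- A collection of Bernoulli reward distributions: `mean i j` is the mean reward, in `(0,1)`,
of player `i` on arm `j`. The collection is indexed by all pairs of natural numbers; a problem
with `N` players and `K` arms uses the pairs with `i < N` and `j < K`. -/
structure Rewards where
  mean : ℕ → ℕ → ℝ
  mean_pos : ∀ i j, 0 < mean i j
  mean_lt_one : ∀ i j, mean i j < 1

/-- The mean reward of player `i` when assigned to `o`; it is `0` when unmatched. -/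
def Rewards.meanOf (μ : Rewards) {N K : ℕ} (i : Fin N) (o : Option (Fin K)) : ℝ :=
  match o with
  | none => 0
  | some j => μ.mean i j

theorem Rewards.meanOf_nonneg (μ : Rewards) {N K : ℕ} (i : Fin N) (o : Option (Fin K)) :
    0 ≤ μ.meanOf i o := by
  cases o with
  | none => exact le_rfl
  | some j => exact (μ.mean_pos i j).le

theorem Rewards.meanOf_le_one (μ : Rewards) {N K : ℕ} (i : Fin N) (o : Option (Fin K)) :
    μ.meanOf i o ≤ 1 := by
  cases o with
  | none => exact zero_le_one
  | some j => exact (μ.mean_lt_one i j).le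

/-- The pair `(i, j)` is a blocking pair for the matching `m`. -/
def RoundInfo.IsBlockingPair {N K : ℕ} (I : RoundInfo N K) (μ : Rewards) (m : Assignment N K)
    (i : Fin N) (j : Fin K) : Prop :=
  i ∈ I.players ∧ j ∈ I.arms ∧ μ.meanOf i (m i) < μ.mean i j ∧
    ((m.matched j).card < I.cap j ∨ ∃ i' ∈ m.matched j, I.prefers j i i')

/-- `m` is a stable matching for the round, given the true mean rewards `μ`. -/
def RoundInfo.IsStable {N K : ℕ} (I : RoundInfo N K) (μ : Rewards) (m : Assignment N K) : Prop :=
  I.IsMatching m ∧ ∀ i j, ¬ I.IsBlockingPair μ m i j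

/-- `m` is the player-optimal stable matching: stable, and for every available player at least as
good as any stable matching. -/
def RoundInfo.IsPlayerOptimal {N K : ℕ} (I : RoundInfo N K) (μ : Rewards)
    (m : Assignment N K) : Prop :=
  I.IsStable μ m ∧ ∀ m', I.IsStable μ m' → ∀ i ∈ I.players, μ.meanOf i (m' i) ≤ μ.meanOf i (m i)

/-- `m` is the player-pessimal stable matching: stable, and for every available player at most as
good as any stable matching. -/
def RoundInfo.IsPlayerPessimal {N K : ℕ} (I : RoundInfo N K) (μ : Rewards)
    (m : Assignment N K) : Prop :=
  I.IsStable μ m ∧ ∀ m', I.IsStable μ m' → ∀ i ∈ I.players, μ.meanOf i (m i) ≤ μ.meanOf i (m' i)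

/-- The player-optimal stable matching of the round (it exists by the theorem of Gale and Shapley,
and the mean reward that it gives to each player does not depend on the choice). -/
noncomputable def RoundInfo.playerOptimal {N K : ℕ} (I : RoundInfo N K) (μ : Rewards) :
    Assignment N K :=
  Classical.epsilon (I.IsPlayerOptimal μ)

/-- The player-pessimal stable matching of the round. -/
noncomputable def RoundInfo.playerPessimal {N K : ℕ} (I : RoundInfo N K) (μ : Rewards) :
    Assignment N K :=
  Classical.epsilon (I.IsPlayerPessimal μ)

/-- What the platform has seen of a finished round: the information given at its beginning, the
matching that was chosen, and the rewards (`true` is reward `1` and `false` is reward `0`). -/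
structure Record (N K : ℕ) where
  info : RoundInfo N K
  matching : Assignment N K
  reward : Fin N → Bool

/-- A (possibly randomized) policy: given the numbers `N` of players and `K` of arms, the horizon
`T`, the records of the past rounds (most recent first) and the information on the current round,
a probability distribution on the matchings of the current round. -/
def Policy : Type :=
  ∀ N K _T : ℕ, List (Record N K) → ∀ I : RoundInfo N K, PMF {m : Assignment N K // I.IsMatching m}

/-- The law of independent rewards, the one of player `i` being Bernoulli with mean `p i`. -/
noncomputable def rewardLaw {N : ℕ} (p : Fin N → ℝ) (h0 : ∀ i, 0 ≤ p i) (h1 : ∀ i, p i ≤ 1) :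
    PMF (Fin N → Bool) :=
  PMF.ofFintype
    (fun r => ∏ i, (if r i = true then ENNReal.ofReal (p i) else ENNReal.ofReal (1 - p i))) (by
      have h := Finset.prod_univ_sum (fun _ : Fin N => (Finset.univ : Finset Bool))
        (fun i b => if b = true then ENNReal.ofReal (p i) else ENNReal.ofReal (1 - p i))
      rw [Fintype.piFinset_univ] at h
      rw [← h]
      refine Finset.prod_eq_one fun i _ => ?_
      simp only [Fintype.sum_bool, if_true, Bool.false_eq_true, if_false]
      rw [← ENNReal.ofReal_add (h0 i) (by linarith [h1 i])]
      simp)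

/-- The expectation of `f` under the discrete law `P`. -/
noncomputable def expect {α : Type*} (P : PMF α) (f : α → ℝ) : ℝ :=
  ∑' a, (P a).toReal * f a

/-- The non-random part of a problem with horizon `T`, apart from the reward distributions: the
numbers `N ≤ K` of players and arms, and what is revealed in each of the rounds `0, …, T - 1`
(the values of `info` from `T` on play no role). -/
structure Environment (T : ℕ) where
  N : ℕ
  K : ℕ
  N_le_K : N ≤ K
  info : ℕ → RoundInfo N K

namespace Environment

variable {T : ℕ} (E : Environment T)

/-- The law of the record of round `t` given the records `h` of the previous rounds. -/
noncomputable def recordLaw (μ : Rewards) (π : Policy) (t : ℕ) (h : List (Record E.N E.K)) :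
    PMF (Record E.N E.K) :=
  (π E.N E.K T h (E.info t)).bind fun m =>
    (rewardLaw (fun i => μ.meanOf i (m.1 i)) (fun i => μ.meanOf_nonneg i _)
      (fun i => μ.meanOf_le_one i _)).map fun r => ⟨E.info t, m.1, r⟩

/-- The law of the records of the first `t` rounds (most recent first). -/
noncomputable def historyLaw (μ : Rewards) (π : Policy) : ℕ → PMF (List (Record E.N E.K))
  | 0 => PMF.pure []
  | t + 1 => (historyLaw μ π t).bind fun h => (E.recordLaw μ π t h).map fun ρ => ρ :: h

/-- The expected reward of player `i` in round `t`. -/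
noncomputable def expectedReward (μ : Rewards) (π : Policy) (i : Fin E.N) (t : ℕ) : ℝ :=
  expect ((E.historyLaw μ π t).bind fun h => E.recordLaw μ π t h)
    fun ρ => if ρ.reward i = true then 1 else 0

/-- The set of rounds in which player `i` is available. -/
def rounds (i : Fin E.N) : Finset ℕ :=
  (Finset.range T).filter fun t => i ∈ (E.info t).players

/-- The number of rounds in which player `i` is available. -/
def numRounds (i : Fin E.N) : ℕ := (E.rounds i).card

/-- The player-optimal stable regret of player `i`. -/
noncomputable def optimalRegret (μ : Rewards) (π : Policy) (i : Fin E.N) : ℝ :=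
  ∑ t ∈ E.rounds i, (μ.meanOf i ((E.info t).playerOptimal μ i) - E.expectedReward μ π i t)

/-- The player-pessimal stable regret of player `i`. -/
noncomputable def pessimalRegret (μ : Rewards) (π : Policy) (i : Fin E.N) : ℝ :=
  ∑ t ∈ E.rounds i, (μ.meanOf i ((E.info t).playerPessimal μ i) - E.expectedReward μ π i t)

/-- Any two distinct arms that are available in the same round have, for every player, mean rewards
that differ by at least `Δ`. -/
def HasGap (μ : Rewards) (Δ : ℝ) : Prop :=
  ∀ t < T, ∀ i : Fin E.N, ∀ j ∈ (E.info t).arms, ∀ j' ∈ (E.info t).arms, j ≠ j' →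
    Δ ≤ |μ.mean i j - μ.mean i j'|

/-- One target player, available in every round, on the same two arms of capacity one in every
round, faces a stream of fresh competitors, one for each block of `L` consecutive rounds; the
available players are the target and the current competitor, whom both arms prefer. -/
def IsBlockStream (L : ℕ) : Prop :=
  ∃ (target : Fin E.N) (competitor : ℕ → Fin E.N) (a₁ a₂ : Fin E.K), a₁ ≠ a₂ ∧
    (∀ t < T, ∀ t' < T, competitor (t / L) = competitor (t' / L) → t / L = t' / L) ∧
    ∀ t < T,
      competitor (t / L) ≠ target ∧
      (E.info t).players = {target, competitor (t / L)} ∧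
      (E.info t).arms = {a₁, a₂} ∧
      ∀ j ∈ (E.info t).arms,
        (E.info t).cap j = 1 ∧ (E.info t).prefers j (competitor (t / L)) target

end Environment

/-- `α`-consistency. The reward distributions `μ` are fixed, with gaps bounded away from zero; the
environment may be any one for each horizon `T`, so that the numbers of players and arms may grow
with `T`. For every `c > α`, the player-optimal or the player-pessimal regret of any player `i T`
with `T_i → ∞` is bounded by `o(T_i ^ c)`. -/
def Policy.IsConsistent (π : Policy) (α : ℝ) : Prop :=
  ∀ (μ : Rewards) (Δ : ℝ), 0 < Δ → ∀ E : ∀ T : ℕ, Environment T, (∀ T, (E T).HasGap μ Δ) →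
    ∀ i : ∀ T : ℕ, Fin (E T).N, Tendsto (fun T => (E T).numRounds (i T)) atTop atTop →
    ∀ c : ℝ, α < c →
      (∀ ε : ℝ, 0 < ε → ∀ᶠ T in atTop,
        (E T).optimalRegret μ π (i T) ≤ ε * ((E T).numRounds (i T) : ℝ) ^ c) ∨
      (∀ ε : ℝ, 0 < ε → ∀ᶠ T in atTop,
        (E T).pessimalRegret μ π (i T) ≤ ε * ((E T).numRounds (i T) : ℝ) ^ c)

end SleepingBandit

open SleepingBandit

/-! The target gains only from arm `1` (mean `3/4`, against `1/2` elsewhere), but each fresh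
competitor outranks it there, and the platform cannot know whether the competitor prefers arm `1`
(mean `3/4`) or arm `0` (`1/4` on arm `1`) without letting it try. Each trial takes arm `1` away
from the target.

Fix the baseline in which no competitor likes arm `1`, with blocks of length `L ≈ T^(1-c)` and a
threshold `k → ∞`. If, under the baseline, every competitor of a full block has at least `k/2`
expected trials, the target loses arm `1` about `T^c * k/2` times up to a constant, because the arm
has capacity one (`sum_expectedPulls_le_expectedMisses`, `le_pessimalRegret_target`). Otherwise some
competitor has at most `k/2` expected trials. Raise its mean on arm `1` to `3/4`: each trial changes
the likelihood by a factor of at most `3` (`historyLaw_le_pow_mul`), so it still misses arm `1`, now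
its stable partner, at least `(L - k)/(2 * 3^k)` times in expectation (`le_expectedMisses`,
`le_pessimalRegret_rival`). With `3^k ≤ L^((1-c)/2)` this is of order `L^((1+c)/2)` at least, which
dominates `L^c`.

The reward means must not depend on `T`. Competitors of different horizons therefore have different
indices, and one set `S` collects the modified competitor of every horizon that has one
(`exists_rewards`). The suffering player is the target at some horizons and a competitor at others.
Stable matchings are unique on the available players, so both regrets coincide. Inconsistency
follows by taking `c` between `α` and `1`. -/

namespace SleepingBandit

open scoped ENNReal

/-! ### Expectations under discrete laws and Bernoulli reward vectors. -/

/-- The expectation of an extended nonnegative function under a discrete law. -/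
noncomputable def lexpect {α : Type*} (P : PMF α) (F : α → ℝ≥0∞) : ℝ≥0∞ := ∑' a, P a * F a

section lexpect

variable {α β : Type*}

theorem lexpect_pure (a : α) (F : α → ℝ≥0∞) : lexpect (PMF.pure a) F = F a := by
  unfold lexpect
  rw [tsum_eq_single a]
  · simp
  · intro b hb
    simp [hb]

theorem lexpect_bind (P : PMF α) (f : α → PMF β) (F : β → ℝ≥0∞) :
    lexpect (P.bind f) F = lexpect P fun a => lexpect (f a) F := by
  simp only [lexpect, PMF.bind_apply, ← ENNReal.tsum_mul_right, ← ENNReal.tsum_mul_left]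
  rw [ENNReal.tsum_comm]
  simp only [mul_assoc]

theorem lexpect_map (P : PMF α) (f : α → β) (F : β → ℝ≥0∞) :
    lexpect (P.map f) F = lexpect P fun a => F (f a) := by
  simp only [PMF.map, lexpect_bind, Function.comp_apply, lexpect_pure]

theorem lexpect_mono {P : PMF α} {F G : α → ℝ≥0∞} (h : ∀ a ∈ P.support, F a ≤ G a) :
    lexpect P F ≤ lexpect P G := by
  refine ENNReal.tsum_le_tsum fun a => ?_
  by_cases ha : P a = 0
  · simp [ha]
  · exact mul_le_mul_right (h a ((PMF.mem_support_iff _ _).2 ha)) _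

theorem lexpect_congr {P : PMF α} {F G : α → ℝ≥0∞} (h : ∀ a ∈ P.support, F a = G a) :
    lexpect P F = lexpect P G :=
  le_antisymm (lexpect_mono fun a ha => (h a ha).le) (lexpect_mono fun a ha => (h a ha).ge)

theorem lexpect_add (P : PMF α) (F G : α → ℝ≥0∞) :
    lexpect P (fun a => F a + G a) = lexpect P F + lexpect P G := by
  simp only [lexpect, mul_add, ENNReal.tsum_add]

theorem lexpect_const_mul (P : PMF α) (c : ℝ≥0∞) (F : α → ℝ≥0∞) :
    lexpect P (fun a => c * F a) = c * lexpect P F := by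
  simp only [lexpect, ← ENNReal.tsum_mul_left, mul_left_comm]

theorem lexpect_const (P : PMF α) (c : ℝ≥0∞) : lexpect P (fun _ => c) = c := by
  simp only [lexpect, ENNReal.tsum_mul_right, PMF.tsum_coe, one_mul]

theorem lexpect_finset_sum {ι : Type*} (s : Finset ι) (P : PMF α) (F : ι → α → ℝ≥0∞) :
    lexpect P (fun a => ∑ i ∈ s, F i a) = ∑ i ∈ s, lexpect P (F i) := by
  classical
  induction s using Finset.induction_on with
  | empty => simp [lexpect]
  | insert i s hi ih => simp only [Finset.sum_insert hi, lexpect_add, ih]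

theorem expect_indicator (P : PMF α) (p : α → Prop) [DecidablePred p] :
    expect P (fun a => if p a then 1 else 0) = (lexpect P fun a => if p a then 1 else 0).toReal := by
  unfold expect lexpect
  rw [ENNReal.tsum_toReal_eq]
  · refine tsum_congr fun a => ?_
    dsimp only; split_ifs <;> simp
  · intro a
    dsimp only; split_ifs <;> simp [PMF.apply_ne_top]

end lexpect

/-- The indicator is written as a product over players that is trivial off `i`, so that the sum over
outcomes factors; every factor other than that of `i` equals `1`. -/
theorem lexpect_rewardLaw {N : ℕ} (p : Fin N → ℝ) (h0 : ∀ i, 0 ≤ p i) (h1 : ∀ i, p i ≤ 1)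
    (i : Fin N) :
    lexpect (rewardLaw p h0 h1) (fun r => if r i = true then 1 else 0) = ENNReal.ofReal (p i) := by
  have h := Finset.prod_univ_sum (fun _ : Fin N => (Finset.univ : Finset Bool))
    (fun k b => (if b = true then ENNReal.ofReal (p k) else ENNReal.ofReal (1 - p k)) *
      if k = i then (if b = true then 1 else 0) else 1)
  rw [Fintype.piFinset_univ] at h
  unfold lexpect rewardLaw
  rw [tsum_fintype]
  have h2 : ∀ r : Fin N → Bool, (∏ k, (if k = i then (if r k = true then (1 : ℝ≥0∞) else 0) else 1))
      = if r i = true then 1 else 0 := by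
    intro r
    rw [Finset.prod_ite_eq' Finset.univ i]
    simp
  simp only [Finset.prod_mul_distrib, h2] at h
  simp only [PMF.ofFintype_apply]
  rw [← h, Finset.prod_eq_single i]
  · simp
  · intro k _ hk
    simp only [hk, if_false, mul_one, Fintype.sum_bool, if_true, Bool.false_eq_true]
    rw [← ENNReal.ofReal_add (h0 k) (by linarith [h1 k])]
    simp
  · simp

/-- One-round likelihood ratio: coordinates other than `b` cancel, and the two hypotheses on `b`
treat rewards `1` and `0`. -/
theorem rewardLaw_le_mul {N : ℕ} {p q : Fin N → ℝ} {hp0 : ∀ i, 0 ≤ p i} {hp1 : ∀ i, p i ≤ 1}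
    {hq0 : ∀ i, 0 ≤ q i} {hq1 : ∀ i, q i ≤ 1} (b : Fin N) (C : ℝ) (hC : 0 ≤ C)
    (hpq : ∀ i, i ≠ b → p i = q i) (hb : p b ≤ C * q b) (hb' : 1 - p b ≤ C * (1 - q b))
    (r : Fin N → Bool) :
    rewardLaw p hp0 hp1 r ≤ ENNReal.ofReal C * rewardLaw q hq0 hq1 r := by
  unfold rewardLaw
  simp only [PMF.ofFintype_apply]
  rw [← Finset.mul_prod_erase Finset.univ _ (Finset.mem_univ b),
    ← Finset.mul_prod_erase Finset.univ _ (Finset.mem_univ b), ← mul_assoc]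
  refine mul_le_mul' ?_ (le_of_eq (Finset.prod_congr rfl fun i hi => ?_))
  · split_ifs
    · rw [← ENNReal.ofReal_mul hC]
      exact ENNReal.ofReal_le_ofReal hb
    · rw [← ENNReal.ofReal_mul hC]
      exact ENNReal.ofReal_le_ofReal hb'
  · rw [hpq i (Finset.ne_of_mem_erase hi)]

/-! ### Stable matchings with two players and two arms. -/

namespace RoundInfo

variable {N K : ℕ} {I : RoundInfo N K} {μ : Rewards} {p q : Fin N} {f o : Fin K}

/-- At a round with two players and two arms of capacity one, where the favourite arm `f` of `q`
ranks `q` first, a stable matching gives `f` to `q` and the other arm to `p`. -/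
theorem IsStable.eq_of_two (hfo : f ≠ o) (hpq : q ≠ p) (hI : I.players = {p, q})
    (hA : I.arms = {f, o}) (hf : I.cap f = 1) (ho : I.cap o = 1) (hpref : I.prefers f q p)
    (hμ : μ.mean q o < μ.mean q f) {m : Assignment N K} (hm : I.IsStable μ m) :
    m q = some f ∧ m p = some o := by
  have harm : ∀ i j, m i = some j → j = f ∨ j = o := fun i j h => by
    simpa [hA] using hm.1.arm_mem i j h
  have hpl : ∀ i j, m i = some j → i = p ∨ i = q := fun i j h => by
    by_contra hc
    have := hm.1.player_mem i (by simpa [hI] using hc)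
    simp [this] at h
  -- Otherwise `(q, f)` blocks: `f` is either held by `p`, whom it ranks below `q`, or empty.
  have hq : m q = some f := by
    by_contra hne
    refine hm.2 q f ⟨by simp [hI], by simp [hA], ?_, ?_⟩
    · cases hmq : m q with
      | none => exact μ.mean_pos _ _
      | some j =>
        rcases harm q j hmq with rfl | rfl
        · exact absurd hmq hne
        · exact hμ
    · by_cases hmp : m p = some f
      · exact Or.inr ⟨p, by simp [Assignment.matched, hmp], hpref⟩
      · left
        rw [hf, Nat.lt_one_iff, Finset.card_eq_zero, Finset.eq_empty_iff_forall_notMem]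
        intro i hi
        have hi' : m i = some f := by simpa [Assignment.matched] using hi
        rcases hpl i f hi' with rfl | rfl
        · exact hmp hi'
        · exact hne hi'
  refine ⟨hq, ?_⟩
  have hpf : m p ≠ some f := by
    intro h
    have h1 := hm.1.card_le f (by simp [hA])
    rw [hf, Finset.card_le_one] at h1
    exact hpq (h1 q (by simp [Assignment.matched, hq]) p (by simp [Assignment.matched, h]))
  cases hmp : m p with
  | some j =>
    rcases harm p j hmp with rfl | rfl
    · exact absurd hmp hpf
    · rfl
  | none =>
    exfalso
    -- Since `q` holds `f` and `p` is unmatched, `o` is empty; as means are positive, `(p, o)`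
    -- blocks.
    refine hm.2 p o ⟨by simp [hI], by simp [hA], ?_, Or.inl ?_⟩
    · rw [hmp]
      exact μ.mean_pos _ _
    · rw [ho, Nat.lt_one_iff, Finset.card_eq_zero, Finset.eq_empty_iff_forall_notMem]
      intro i hi
      have hi' : m i = some o := by simpa [Assignment.matched] using hi
      rcases hpl i o hi' with rfl | rfl
      · simp [hmp] at hi'
      · rw [hq] at hi'
        exact hfo (Option.some.inj hi')

theorem exists_isStable_of_two (hfo : f ≠ o) (hpq : q ≠ p) (hI : I.players = {p, q})
    (hA : I.arms = {f, o}) (hf : I.cap f = 1) (ho : I.cap o = 1) (hpref : I.prefers f q p)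
    (hμ : μ.mean q o < μ.mean q f) : ∃ m, I.IsStable μ m := by
  classical
  let m : Assignment N K := fun i => if i = q then some f else if i = p then some o else none
  have hmq : m q = some f := by simp [m]
  have hmp : m p = some o := by simp [m, hpq.symm]
  have hmf : m.matched f = {q} := by
    ext i
    simp only [Assignment.matched, m, Finset.mem_filter, Finset.mem_univ, true_and,
      Finset.mem_singleton]
    split_ifs with h1 h2 <;> simp [h1, hfo.symm]
  have hmo : m.matched o = {p} := by
    ext i
    simp only [Assignment.matched, m, Finset.mem_filter, Finset.mem_univ, true_and,
      Finset.mem_singleton]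
    split_ifs with h1 h2
    · simp [h1, hfo, hpq]
    · simp [h2]
    · simp [h2]
  refine ⟨m, ⟨fun i hi => ?_, fun i j hij => ?_, fun j hj => ?_⟩, ?_⟩
  · simp only [hI, Finset.mem_insert, Finset.mem_singleton, not_or] at hi
    simp [m, hi.1, hi.2]
  · simp only [m] at hij
    rw [hA]
    split_ifs at hij <;> simp_all
  · rw [hA, Finset.mem_insert, Finset.mem_singleton] at hj
    rcases hj with rfl | rfl
    · simp [hmf, hf]
    · simp [hmo, ho]
  · rintro i j ⟨hi, hj, hlt, hbl⟩
    rw [hA, Finset.mem_insert, Finset.mem_singleton] at hj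
    rw [hI, Finset.mem_insert, Finset.mem_singleton] at hi
    rcases hi with rfl | rfl
    · rcases hj with rfl | rfl
      · rw [hmf, hf] at hbl
        rcases hbl with h | ⟨i', hi', h⟩
        · simp at h
        · rw [Finset.mem_singleton] at hi'
          subst hi'
          refine I.prefers_irrefl j (by simp [hA]) i (by simp [hI]) ?_
          exact I.prefers_trans j (by simp [hA]) i (by simp [hI]) i' (by simp [hI]) i
            (by simp [hI]) h hpref
      · rw [hmp] at hlt
        exact lt_irrefl _ hlt
    · rw [hmq] at hlt
      rcases hj with rfl | rfl
      · exact lt_irrefl _ hlt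
      · exact lt_asymm hlt hμ

/-- All stable matchings agree on the available players, so any of them is both optimal and
pessimal; this makes the two `Classical.epsilon` choices meaningful. -/
theorem isStable_playerOptimal_playerPessimal_of_two (hfo : f ≠ o) (hpq : q ≠ p)
    (hI : I.players = {p, q}) (hA : I.arms = {f, o}) (hf : I.cap f = 1) (ho : I.cap o = 1)
    (hpref : I.prefers f q p) (hμ : μ.mean q o < μ.mean q f) :
    I.IsStable μ (I.playerOptimal μ) ∧ I.IsStable μ (I.playerPessimal μ) := by
  obtain ⟨m, hm⟩ := exists_isStable_of_two hfo hpq hI hA hf ho hpref hμ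
  have key : ∀ m', I.IsStable μ m' → ∀ i ∈ I.players, m' i = m i := by
    intro m' hm' i hi
    have h1 := hm.eq_of_two hfo hpq hI hA hf ho hpref hμ
    have h2 := hm'.eq_of_two hfo hpq hI hA hf ho hpref hμ
    rw [hI, Finset.mem_insert, Finset.mem_singleton] at hi
    rcases hi with rfl | rfl
    · rw [h1.2, h2.2]
    · rw [h1.1, h2.1]
  refine ⟨?_, ?_⟩
  · have : I.IsPlayerOptimal μ (I.playerOptimal μ) :=
      Classical.epsilon_spec ⟨m, hm, fun m' hm' i hi => by rw [key m' hm' i hi]⟩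
    exact this.1
  · have : I.IsPlayerPessimal μ (I.playerPessimal μ) :=
      Classical.epsilon_spec ⟨m, hm, fun m' hm' i hi => by rw [key m' hm' i hi]⟩
    exact this.1

end RoundInfo

end SleepingBandit

namespace SleepingBandit

open scoped ENNReal

/-! ### Laws of histories and the change of measure. -/

namespace Environment

variable {T : ℕ} (E : Environment T)

/-- The law of the record of round `t`. -/
noncomputable def stepLaw (μ : Rewards) (π : Policy) (t : ℕ) : PMF (Record E.N E.K) :=
  (E.historyLaw μ π t).bind fun h => E.recordLaw μ π t h

variable {E} {μ μ' : Rewards} {π : Policy}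

theorem of_mem_support_recordLaw {t : ℕ} {h : List (Record E.N E.K)} {ρ : Record E.N E.K}
    (hρ : ρ ∈ (E.recordLaw μ π t h).support) :
    ρ.info = E.info t ∧ (E.info t).IsMatching ρ.matching := by
  simp only [recordLaw, PMF.mem_support_bind_iff, PMF.mem_support_map_iff] at hρ
  obtain ⟨m, -, r, -, rfl⟩ := hρ
  exact ⟨rfl, m.2⟩

theorem of_mem_support_stepLaw {t : ℕ} {ρ : Record E.N E.K}
    (hρ : ρ ∈ (E.stepLaw μ π t).support) :
    ρ.info = E.info t ∧ (E.info t).IsMatching ρ.matching := by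
  simp only [stepLaw, PMF.mem_support_bind_iff] at hρ
  obtain ⟨h, -, hρ⟩ := hρ
  exact of_mem_support_recordLaw hρ

theorem historyLaw_succ_cons (t : ℕ) (ρ : Record E.N E.K) (h : List (Record E.N E.K)) :
    E.historyLaw μ π (t + 1) (ρ :: h) = E.historyLaw μ π t h * E.recordLaw μ π t h ρ := by
  rw [historyLaw, PMF.bind_apply, tsum_eq_single h]
  · rw [PMF.map_apply, tsum_eq_single ρ]
    · simp
    · intro ρ' hρ'
      simp [hρ'.symm]
  · intro h' hh'
    rw [PMF.map_apply]
    simp [hh'.symm]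

theorem historyLaw_succ_nil (t : ℕ) : E.historyLaw μ π (t + 1) [] = 0 := by
  rw [historyLaw, PMF.bind_apply]
  simp [PMF.map_apply]

/-- Linearity of expectation: counts along a history become sums over rounds of one-round
expectations. -/
theorem lexpect_historyLaw_sum (f : Record E.N E.K → ℝ≥0∞) (t : ℕ) :
    lexpect (E.historyLaw μ π t) (fun h => (h.map f).sum) =
      ∑ s ∈ Finset.range t, lexpect (E.stepLaw μ π s) f := by
  induction t with
  | zero => simp [historyLaw, lexpect_pure]
  | succ t ih =>
    rw [Finset.sum_range_succ, ← ih, historyLaw, lexpect_bind, stepLaw, lexpect_bind, ← lexpect_add]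
    refine lexpect_congr fun h _ => ?_
    rw [lexpect_map]
    simp only [List.map_cons, List.sum_cons, lexpect_add, lexpect_const]
    rw [add_comm]

/-- In a history of positive probability, the rounds at which `i` is available split into those at
which `i` is matched to `a` and the others. -/
theorem count_add_count_of_mem_support (i : Fin E.N) (a : Fin E.K) {t : ℕ}
    {h : List (Record E.N E.K)} (hh : h ∈ (E.historyLaw μ π t).support) :
    (h.map fun ρ => if ρ.matching i = some a then 1 else 0).sum +
      (h.map fun ρ => if i ∈ ρ.info.players ∧ ρ.matching i ≠ some a then 1 else 0).sum =
      ((Finset.range t).filter fun s => i ∈ (E.info s).players).card := by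
  induction t generalizing h with
  | zero =>
    simp only [historyLaw, PMF.support_pure, Set.mem_singleton_iff] at hh
    simp [hh]
  | succ t ih =>
    simp only [historyLaw, PMF.mem_support_bind_iff, PMF.mem_support_map_iff] at hh
    obtain ⟨h', hh', ρ, hρ, rfl⟩ := hh
    obtain ⟨hinfo, hmat⟩ := of_mem_support_recordLaw hρ
    rw [Finset.range_add_one, Finset.filter_insert]
    have := ih hh'
    simp only [List.map_cons, List.sum_cons, hinfo]
    by_cases hi : i ∈ (E.info t).players
    · rw [if_pos hi, Finset.card_insert_of_notMem (by simp), ← this]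
      by_cases hm : ρ.matching i = some a
      · simp [hm]
        omega
      · simp [hm, hi]
        omega
    · rw [if_neg hi, ← this]
      simp [hi, hmat.player_mem i hi]

/-- Two collections of rewards which agree wherever they can be observed give the same law. -/
theorem historyLaw_congr
    (hμ : ∀ t, ∀ i ∈ (E.info t).players, ∀ j ∈ (E.info t).arms, μ.mean i j = μ'.mean i j) (t : ℕ) :
    E.historyLaw μ π t = E.historyLaw μ' π t := by
  have hrec : ∀ t h, E.recordLaw μ π t h = E.recordLaw μ' π t h := by
    intro t h
    unfold recordLaw
    congr 1
    funext m
    have : (fun i => μ.meanOf i (m.1 i)) = fun i => μ'.meanOf i (m.1 i) := by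
      funext i
      cases hmi : m.1 i with
      | none => rfl
      | some j =>
        refine hμ t i ?_ j (m.2.arm_mem i j hmi)
        by_contra hc
        simp [m.2.player_mem i hc] at hmi
    simp only [this]
  induction t with
  | zero => rfl
  | succ t ih => simp only [historyLaw, ih, hrec]

/-- The change of measure when only the mean of `b` on the arm `a` is modified. -/
theorem historyLaw_le_pow_mul (b : Fin E.N) (a : Fin E.K) {C : ℝ} (hC : 1 ≤ C)
    (hμ : ∀ t, ∀ i ∈ (E.info t).players, ∀ j ∈ (E.info t).arms, (i ≠ b ∨ j ≠ a) →
      μ.mean i j = μ'.mean i j)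
    (hb : μ.mean b a ≤ C * μ'.mean b a) (hb' : 1 - μ.mean b a ≤ C * (1 - μ'.mean b a))
    (t : ℕ) (h : List (Record E.N E.K)) :
    E.historyLaw μ π t h ≤
      ENNReal.ofReal C ^ (h.map fun ρ => if ρ.matching b = some a then 1 else 0).sum *
        E.historyLaw μ' π t h := by
  -- The policy contributes the same factor on both sides, so only the reward law matters, and it
  -- differs only when `b` is matched to `a`.
  have hrec : ∀ t h ρ, E.recordLaw μ π t h ρ ≤
      ENNReal.ofReal C ^ (if ρ.matching b = some a then 1 else 0) * E.recordLaw μ' π t h ρ := by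
    intro t h ρ
    unfold recordLaw
    rw [PMF.bind_apply, PMF.bind_apply, ← ENNReal.tsum_mul_left]
    refine ENNReal.tsum_le_tsum fun m => ?_
    rw [mul_left_comm]
    refine mul_le_mul_right ?_ _
    rw [PMF.map_apply, PMF.map_apply, ← ENNReal.tsum_mul_left]
    refine ENNReal.tsum_le_tsum fun r => ?_
    split_ifs with h1 h2 h2
    · subst h1
      rw [pow_one]
      refine rewardLaw_le_mul b C (by linarith) (fun i hi => ?_) ?_ ?_ r
      · cases hmi : m.1 i with
        | none => rfl
        | some j =>
          refine hμ t i ?_ j (m.2.arm_mem i j hmi) (Or.inl hi)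
          by_contra hc
          simp [m.2.player_mem i hc] at hmi
      · simp only at h2
        rw [h2]
        exact hb
      · simp only at h2
        rw [h2]
        exact hb'
    · subst h1
      rw [pow_zero, one_mul]
      refine le_of_eq ?_
      have : (fun i => μ.meanOf i (m.1 i)) = fun i => μ'.meanOf i (m.1 i) := by
        funext i
        cases hmi : m.1 i with
        | none => rfl
        | some j =>
          refine hμ t i ?_ j (m.2.arm_mem i j hmi) ?_
          · by_contra hc
            simp [m.2.player_mem i hc] at hmi
          · by_contra! hc
            obtain ⟨rfl, rfl⟩ := hc
            exact h2 hmi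
      simp only [this]
    · simp
    · simp
  induction t generalizing h with
  | zero =>
    cases h with
    | nil => simp [historyLaw]
    | cons ρ h => simp [historyLaw]
  | succ t ih =>
    cases h with
    | nil => simp [historyLaw_succ_nil]
    | cons ρ h =>
      rw [historyLaw_succ_cons, historyLaw_succ_cons, List.map_cons, List.sum_cons, pow_add]
      calc _ ≤ _ := mul_le_mul' (ih h) (hrec t h ρ)
        _ = _ := by ring

theorem natCast_sum_map {N K : ℕ} (p : Record N K → Prop) [DecidablePred p]
    (h : List (Record N K)) :
    (((h.map fun ρ => if p ρ then 1 else 0).sum : ℕ) : ℝ≥0∞) =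
      (h.map fun ρ => if p ρ then 1 else 0).sum := by
  induction h with
  | nil => simp
  | cons ρ h ih => simp only [List.map_cons, List.sum_cons, Nat.cast_add, ih]; split_ifs <;> simp

/-! ### Pulls, misses and their transfer between two reward collections. -/

/-- The expected number of rounds at which `i` is matched to `a`. -/
noncomputable def expectedPulls (E : Environment T) (μ : Rewards) (π : Policy) (i : Fin E.N)
    (a : Fin E.K) : ℝ≥0∞ :=
  lexpect (E.historyLaw μ π T) fun h => (h.map fun ρ => if ρ.matching i = some a then 1 else 0).sum

/-- The expected number of rounds at which `i` is available and not matched to `a`. -/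
noncomputable def expectedMisses (E : Environment T) (μ : Rewards) (π : Policy) (i : Fin E.N)
    (a : Fin E.K) : ℝ≥0∞ :=
  lexpect (E.historyLaw μ π T) fun h =>
    (h.map fun ρ => if i ∈ ρ.info.players ∧ ρ.matching i ≠ some a then 1 else 0).sum

theorem expectedMisses_eq_sum (i : Fin E.N) (a : Fin E.K) :
    E.expectedMisses μ π i a = ∑ t ∈ E.rounds i,
      lexpect (E.stepLaw μ π t) fun ρ => if ρ.matching i ≠ some a then 1 else 0 := by
  rw [expectedMisses, lexpect_historyLaw_sum, rounds, Finset.sum_filter]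
  refine Finset.sum_congr rfl fun t _ => ?_
  split_ifs with hi
  · refine lexpect_congr fun ρ hρ => ?_
    rw [(of_mem_support_stepLaw hρ).1]
    simp [hi]
  · conv_rhs => rw [← lexpect_const (E.stepLaw μ π t) 0]
    refine lexpect_congr fun ρ hρ => ?_
    rw [(of_mem_support_stepLaw hρ).1]
    simp [hi]

/-- If `b` is rarely matched to `a` under `μ`, then under `μ'` it is often not matched to `a`. -/
theorem le_expectedMisses (b : Fin E.N) (a : Fin E.K) {C : ℕ} (hC : 1 ≤ C)
    (hμ : ∀ t, ∀ i ∈ (E.info t).players, ∀ j ∈ (E.info t).arms, (i ≠ b ∨ j ≠ a) →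
      μ.mean i j = μ'.mean i j)
    (hb : μ.mean b a ≤ C * μ'.mean b a) (hb' : 1 - μ.mean b a ≤ C * (1 - μ'.mean b a))
    {k : ℕ} (hk : 0 < k) (hpulls : 2 * E.expectedPulls μ π b a ≤ k) :
    ((E.numRounds b - k : ℕ) : ℝ≥0∞) ≤ 2 * C ^ k * E.expectedMisses μ' π b a := by
  set D : ℕ := E.numRounds b - k with hD
  -- Markov's inequality and the change of measure in one pointwise bound: histories with at least
  -- `k` pulls are paid for by the first term; the others have at least `D` misses and likelihood
  -- ratio at most `C ^ k`.
  have hpt : ∀ h, E.historyLaw μ π T h * ((D : ℝ≥0∞) * k) ≤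
      E.historyLaw μ π T h * (D * ((h.map fun ρ => if ρ.matching b = some a then 1 else 0).sum)) +
      E.historyLaw μ' π T h * ((C ^ k * k) * ((h.map fun ρ =>
        if b ∈ ρ.info.players ∧ ρ.matching b ≠ some a then 1 else 0).sum)) := by
    intro h
    by_cases hs : E.historyLaw μ π T h = 0
    · simp [hs]
    have hcount := count_add_count_of_mem_support b a ((PMF.mem_support_iff _ _).2 hs)
    have hle := historyLaw_le_pow_mul (π := π) b a (C := C) (by exact_mod_cast hC) hμ hb hb' T h
    rw [ENNReal.ofReal_natCast] at hle
    rw [← natCast_sum_map, ← natCast_sum_map]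
    set n := (h.map fun ρ => if ρ.matching b = some a then 1 else 0).sum
    set n' := (h.map fun ρ => if b ∈ ρ.info.players ∧ ρ.matching b ≠ some a then 1 else 0).sum
    change n + n' = E.numRounds b at hcount
    rcases le_or_gt k n with hn | hn
    · refine le_add_right (mul_le_mul_right (mul_le_mul_right ?_ _) _)
      exact_mod_cast hn
    · refine le_add_left ?_
      have h1 : (D : ℝ≥0∞) ≤ n' := by
        have : D ≤ n' := by omega
        exact_mod_cast this
      have h2 : (C : ℝ≥0∞) ^ n ≤ C ^ k := pow_le_pow_right₀ (by exact_mod_cast hC) hn.le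
      calc E.historyLaw μ π T h * (D * k)
          ≤ (C ^ k * E.historyLaw μ' π T h) * (n' * k) :=
            mul_le_mul' (hle.trans (mul_le_mul_left h2 _)) (mul_le_mul_left h1 _)
        _ = _ := by ring
  have hsum := ENNReal.tsum_le_tsum hpt
  rw [ENNReal.tsum_add, ENNReal.tsum_mul_right, PMF.tsum_coe, one_mul] at hsum
  have h1 : (D : ℝ≥0∞) * k ≤ D * E.expectedPulls μ π b a +
      C ^ k * k * E.expectedMisses μ' π b a := by
    unfold expectedPulls expectedMisses
    rw [← lexpect_const_mul, ← lexpect_const_mul]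
    exact hsum
  have hk0 : (k : ℝ≥0∞) ≠ 0 := by exact_mod_cast hk.ne'
  -- After doubling, the pulls cost at most `D * k`, which is finite and cancels.
  have h2 : (D : ℝ≥0∞) * k + D * k ≤ D * k + k * (2 * C ^ k * E.expectedMisses μ' π b a) := by
    calc (D : ℝ≥0∞) * k + D * k = 2 * (D * k) := by ring
      _ ≤ 2 * (D * E.expectedPulls μ π b a + C ^ k * k * E.expectedMisses μ' π b a) :=
        mul_le_mul_right h1 _
      _ = D * (2 * E.expectedPulls μ π b a) + k * (2 * C ^ k * E.expectedMisses μ' π b a) := by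
        ring
      _ ≤ _ := by gcongr
  have hfin : (D : ℝ≥0∞) * k ≠ ⊤ := ENNReal.mul_ne_top (ENNReal.natCast_ne_top _)
    (ENNReal.natCast_ne_top _)
  have h3 := (ENNReal.add_le_add_iff_left hfin).1 h2
  rw [mul_comm] at h3
  exact (ENNReal.mul_le_mul_iff_right hk0 (ENNReal.natCast_ne_top _)).1 h3

/-! ### From misses to regret. -/

theorem lexpect_stepLaw_indicator_le_one (t : ℕ) (p : Record E.N E.K → Prop) [DecidablePred p] :
    lexpect (E.stepLaw μ π t) (fun ρ => if p ρ then 1 else 0) ≤ 1 := by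
  conv_rhs => rw [← lexpect_const (E.stepLaw μ π t) 1]
  refine lexpect_mono fun ρ _ => ?_
  split_ifs <;> simp

/-- Given the matching, the mean reward is `v` on `a` and at most `v - w` otherwise; `hwv` covers
the unmatched case, where it is `0`. -/
theorem expectedReward_add_le (i : Fin E.N) (a : Fin E.K) {v w : ℝ} (hw : 0 ≤ w)
    (ha : μ.mean i a = v) (hne : ∀ j : Fin E.K, j ≠ a → μ.mean i j + w ≤ v) (hwv : w ≤ v) (t : ℕ) :
    E.expectedReward μ π i t + w * (lexpect (E.stepLaw μ π t) fun ρ =>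
      if ρ.matching i ≠ some a then 1 else 0).toReal ≤ v := by
  have key : lexpect (E.stepLaw μ π t) (fun ρ => if ρ.reward i = true then 1 else 0) +
      ENNReal.ofReal w * lexpect (E.stepLaw μ π t)
        (fun ρ => if ρ.matching i ≠ some a then 1 else 0) ≤ ENNReal.ofReal v := by
    rw [← lexpect_const_mul, ← lexpect_add, stepLaw, lexpect_bind]
    conv_rhs => rw [← lexpect_const (E.historyLaw μ π t) (ENNReal.ofReal v)]
    refine lexpect_mono fun h _ => ?_
    rw [recordLaw, lexpect_bind]
    conv_rhs => rw [← lexpect_const (π E.N E.K T h (E.info t)) (ENNReal.ofReal v)]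
    refine lexpect_mono fun m _ => ?_
    rw [lexpect_map, lexpect_add, lexpect_rewardLaw]
    by_cases hm : m.1 i = some a
    · simp only [hm, ne_eq, not_true_eq_false, if_false, mul_zero, lexpect_const, add_zero]
      exact ENNReal.ofReal_le_ofReal ha.le
    · simp only [hm, ne_eq, not_false_eq_true, if_true, mul_one, lexpect_const]
      rw [← ENNReal.ofReal_add (μ.meanOf_nonneg _ _) hw]
      refine ENNReal.ofReal_le_ofReal ?_
      cases hmi : m.1 i with
      | none => simpa [Rewards.meanOf] using hwv
      | some j =>
        refine hne j ?_
        rintro rfl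
        exact hm hmi
  have hv : 0 ≤ v := hw.trans hwv
  have h1 := lexpect_stepLaw_indicator_le_one (μ := μ) (π := π) t
    (fun ρ : Record E.N E.K => ρ.reward i = true)
  have h2 := lexpect_stepLaw_indicator_le_one (μ := μ) (π := π) t
    (fun ρ : Record E.N E.K => ρ.matching i ≠ some a)
  have h1' := ne_top_of_le_ne_top ENNReal.one_ne_top h1
  have h2' := ne_top_of_le_ne_top ENNReal.one_ne_top h2
  have := ENNReal.toReal_mono ENNReal.ofReal_ne_top key
  rw [ENNReal.toReal_add h1' (ENNReal.mul_ne_top ENNReal.ofReal_ne_top h2'), ENNReal.toReal_mul,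
    ENNReal.toReal_ofReal hw, ENNReal.toReal_ofReal hv] at this
  have he : E.expectedReward μ π i t = (lexpect (E.stepLaw μ π t)
      (fun ρ => if ρ.reward i = true then 1 else 0)).toReal :=
    expect_indicator (E.stepLaw μ π t) (fun ρ => ρ.reward i = true)
  rw [he]
  exact this

theorem mul_expectedMisses_le_pessimalRegret (i : Fin E.N) (a : Fin E.K) {v w : ℝ} (hw : 0 ≤ w)
    (ha : μ.mean i a = v) (hne : ∀ j : Fin E.K, j ≠ a → μ.mean i j + w ≤ v) (hwv : w ≤ v)
    (hst : ∀ t ∈ E.rounds i, (E.info t).playerPessimal μ i = some a) :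
    w * (E.expectedMisses μ π i a).toReal ≤ E.pessimalRegret μ π i := by
  rw [expectedMisses_eq_sum, ENNReal.toReal_sum, Finset.mul_sum, pessimalRegret]
  · refine Finset.sum_le_sum fun t ht => ?_
    rw [hst t ht]
    have h1 := expectedReward_add_le (π := π) i a hw ha hne hwv t
    have h2 : μ.meanOf i (some a) = v := ha
    linarith
  · intro t _
    exact ne_top_of_le_ne_top ENNReal.one_ne_top (lexpect_stepLaw_indicator_le_one t _)

theorem expectedMisses_ne_top (i : Fin E.N) (a : Fin E.K) : E.expectedMisses μ π i a ≠ ⊤ := by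
  rw [expectedMisses_eq_sum]
  exact ENNReal.sum_ne_top.2 fun t _ =>
    ne_top_of_le_ne_top ENNReal.one_ne_top (lexpect_stepLaw_indicator_le_one t _)

/-- As `a` has capacity one, at most one player of `B` holds it in a round, and then `p` does not.
-/
theorem sum_expectedPulls_le_expectedMisses (p : Fin E.N) (a : Fin E.K) (B : Finset (Fin E.N))
    (hp : p ∉ B) (hav : ∀ t < T, p ∈ (E.info t).players)
    (hcap : ∀ t < T, a ∈ (E.info t).arms ∧ (E.info t).cap a = 1) :
    ∑ b ∈ B, E.expectedPulls μ π b a ≤ E.expectedMisses μ π p a := by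
  simp only [expectedPulls, expectedMisses, lexpect_historyLaw_sum]
  rw [Finset.sum_comm]
  refine Finset.sum_le_sum fun t ht => ?_
  rw [Finset.mem_range] at ht
  rw [← lexpect_finset_sum]
  refine lexpect_mono fun ρ hρ => ?_
  obtain ⟨hinfo, hmat⟩ := of_mem_support_stepLaw hρ
  have hc := hmat.card_le a (hcap t ht).1
  rw [(hcap t ht).2] at hc
  rw [Finset.sum_boole, hinfo]
  by_cases hpa : ρ.matching p = some a
  · have : B.filter (fun b => ρ.matching b = some a) = ∅ := by
      rw [Finset.filter_eq_empty_iff]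
      intro b hb hba
      rw [Finset.card_le_one] at hc
      have := hc b (by simp [Assignment.matched, hba]) p (by simp [Assignment.matched, hpa])
      exact hp (this ▸ hb)
    simp [this]
  · rw [if_pos ⟨hav t ht, hpa⟩]
    have : (B.filter (fun b => ρ.matching b = some a)).card ≤ 1 :=
      (Finset.card_le_card (Finset.filter_subset_filter _ (Finset.subset_univ B))).trans hc
    exact_mod_cast this

end Environment

end SleepingBandit

namespace SleepingBandit

open scoped ENNReal

/-! ### The hard instances. -/

open Classical in
/-- The rewards for which arm `1` is better than the others for the players in `S` and worse for
the other players. -/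
noncomputable def thresholdRewards (S : Set ℕ) : Rewards where
  mean i j := if j = 1 then (if i ∈ S then 3 / 4 else 1 / 4) else 1 / 2
  mean_pos i j := by split_ifs <;> norm_num
  mean_lt_one i j := by split_ifs <;> norm_num

theorem thresholdRewards_mean_mem {S : Set ℕ} {i : ℕ} (h : i ∈ S) :
    (thresholdRewards S).mean i 1 = 3 / 4 := by
  simp [thresholdRewards, h]

theorem thresholdRewards_mean_notMem {S : Set ℕ} {i : ℕ} (h : i ∉ S) :
    (thresholdRewards S).mean i 1 = 1 / 4 := by
  simp [thresholdRewards, h]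

theorem thresholdRewards_mean_ne {S : Set ℕ} {i j : ℕ} (h : j ≠ 1) :
    (thresholdRewards S).mean i j = 1 / 2 := by
  simp [thresholdRewards, h]

theorem thresholdRewards_mean_congr {S S' : Set ℕ} {i : ℕ} (h : i ∈ S ↔ i ∈ S') (j : ℕ) :
    (thresholdRewards S).mean i j = (thresholdRewards S').mean i j := by
  unfold thresholdRewards
  by_cases hi : i ∈ S
  · have hi' : i ∈ S' := h.1 hi
    simp only [hi, hi']
  · have hi' : i ∉ S' := fun h' => hi (h.2 h')
    simp only [hi, hi']

/-- The index of the competitor of block `b` for the horizon `T`; no index is used twice. -/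
def competitorIndex (T b : ℕ) : ℕ := Nat.pair T b + 1

theorem competitorIndex_inj {T b T' b' : ℕ} :
    competitorIndex T b = competitorIndex T' b' ↔ T = T' ∧ b = b' := by
  simp [competitorIndex, Nat.pair_eq_pair]

/-- The competitor of block `b` as one of the players of the problem with horizon `T`. -/
def competitor (T b : ℕ) : Fin (Nat.pair T T + 2) :=
  -- Truncation at `T` keeps the index in range for all `b`; it changes nothing for the block
  -- numbers `t / L` with `t < T`.
  ⟨competitorIndex T (min b T), by
    have : Nat.pair T (min b T) ≤ Nat.pair T T := by
      rcases (min_le_right b T).lt_or_eq with h | h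
      · exact (Nat.pair_lt_pair_right T h).le
      · rw [h]
    unfold competitorIndex
    omega⟩

theorem competitor_ne_zero (T b : ℕ) : competitor T b ≠ 0 := by
  intro h
  have := congrArg Fin.val h
  simp [competitor, competitorIndex] at this

/-- The environment in which player `0` meets a new competitor in each block of `L` rounds. -/
def streamEnvironment (T L : ℕ) : Environment T where
  N := Nat.pair T T + 2
  K := Nat.pair T T + 2
  N_le_K := le_rfl
  info t :=
    { players := {0, competitor T (t / L)}
      arms := {0, 1}
      prefers := fun _ i i' => i = competitor T (t / L) ∧ i' ≠ competitor T (t / L)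
      cap := fun _ => 1
      prefers_irrefl := fun _ _ _ _ h => h.2 h.1
      prefers_trans := fun _ _ _ _ _ _ _ _ h h' => absurd h'.1 h.2
      prefers_total := by
        intro _ _ i hi i' hi' hne
        simp only [Finset.mem_insert, Finset.mem_singleton] at hi hi'
        have := competitor_ne_zero T (t / L)
        rcases hi with rfl | rfl <;> rcases hi' with rfl | rfl <;> simp_all [eq_comm] }

namespace streamEnvironment

variable {T L : ℕ}

/-- The player who is available in all rounds. -/
def target (T L : ℕ) : Fin (streamEnvironment T L).N := (0 : Fin (Nat.pair T T + 2))

/-- The player who competes with the target in block `b`. -/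
def rival (T L b : ℕ) : Fin (streamEnvironment T L).N := competitor T b

/-- The arm whose mean is `1 / 2` for all players. -/
def safeArm (T L : ℕ) : Fin (streamEnvironment T L).K := (0 : Fin (Nat.pair T T + 2))

/-- The arm whose mean depends on the player. -/
def testArm (T L : ℕ) : Fin (streamEnvironment T L).K := (1 : Fin (Nat.pair T T + 2))

theorem players_info (t : ℕ) :
    ((streamEnvironment T L).info t).players = {target T L, rival T L (t / L)} := rfl

theorem arms_info (t : ℕ) :
    ((streamEnvironment T L).info t).arms = {safeArm T L, testArm T L} := rfl

theorem coe_safeArm : (safeArm T L : ℕ) = 0 := rfl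

theorem coe_testArm : (testArm T L : ℕ) = 1 := Fin.val_one (Nat.pair T T)

theorem safeArm_ne_testArm : safeArm T L ≠ testArm T L := fun h => by
  have := congrArg Fin.val h
  rw [coe_safeArm, coe_testArm] at this
  exact zero_ne_one this

theorem rival_ne_target (b : ℕ) : rival T L b ≠ target T L := competitor_ne_zero T b

theorem prefers_info (t : ℕ) (j : Fin (streamEnvironment T L).K) :
    ((streamEnvironment T L).info t).prefers j (rival T L (t / L)) (target T L) :=
  ⟨rfl, (competitor_ne_zero T (t / L)).symm⟩

theorem coe_rival (b : ℕ) : (rival T L b : ℕ) = competitorIndex T (min b T) := rfl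

theorem coe_rival_of_le {b : ℕ} (hb : b ≤ T) : (rival T L b : ℕ) = competitorIndex T b := by
  rw [coe_rival, min_eq_left hb]

theorem rival_inj {b b' : ℕ} (hb : b ≤ T) (hb' : b' ≤ T) :
    rival T L b = rival T L b' ↔ b = b' := by
  rw [Fin.ext_iff, coe_rival_of_le hb, coe_rival_of_le hb', competitorIndex_inj]
  simp

theorem isBlockStream (T L : ℕ) : (streamEnvironment T L).IsBlockStream L := by
  refine ⟨target T L, rival T L, safeArm T L, testArm T L, safeArm_ne_testArm,
    fun t ht t' ht' h => ?_, fun t _ => ?_⟩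
  · exact (rival_inj ((Nat.div_le_self _ _).trans ht.le) ((Nat.div_le_self _ _).trans ht'.le)).1 h
  · exact ⟨rival_ne_target _, rfl, rfl, fun j _ => ⟨rfl, prefers_info t j⟩⟩

theorem hasGap (S : Set ℕ) (T L : ℕ) :
    (streamEnvironment T L).HasGap (thresholdRewards S) (1 / 4) := by
  intro t _ i j hj j' hj' hne
  rw [arms_info, Finset.mem_insert, Finset.mem_singleton] at hj hj'
  have key : 1 / 4 ≤ |(thresholdRewards S).mean i (safeArm T L) -
      (thresholdRewards S).mean i (testArm T L)| := by
    rw [coe_safeArm, coe_testArm, thresholdRewards_mean_ne zero_ne_one]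
    by_cases h : (i : ℕ) ∈ S
    · rw [thresholdRewards_mean_mem h, le_abs]
      norm_num
    · rw [thresholdRewards_mean_notMem h, le_abs]
      norm_num
  rcases hj with rfl | rfl <;> rcases hj' with rfl | rfl
  · exact absurd rfl hne
  · exact key
  · rw [abs_sub_comm]
    exact key
  · exact absurd rfl hne

theorem mean_safeArm_lt {S : Set ℕ} {i : Fin (streamEnvironment T L).N} (h : (i : ℕ) ∈ S) :
    (thresholdRewards S).mean i (safeArm T L) < (thresholdRewards S).mean i (testArm T L) := by
  rw [coe_safeArm, coe_testArm, thresholdRewards_mean_ne zero_ne_one, thresholdRewards_mean_mem h]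
  norm_num

theorem mean_testArm_lt {S : Set ℕ} {i : Fin (streamEnvironment T L).N} (h : (i : ℕ) ∉ S) :
    (thresholdRewards S).mean i (testArm T L) < (thresholdRewards S).mean i (safeArm T L) := by
  rw [coe_safeArm, coe_testArm, thresholdRewards_mean_ne zero_ne_one,
    thresholdRewards_mean_notMem h]
  norm_num

/-- The stable matchings of a round. -/
theorem eq_of_isStable {S : Set ℕ} {t : ℕ}
    {m : Assignment (streamEnvironment T L).N (streamEnvironment T L).K}
    (hm : ((streamEnvironment T L).info t).IsStable (thresholdRewards S) m) :
    ((rival T L (t / L) : ℕ) ∈ S →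
      m (rival T L (t / L)) = some (testArm T L) ∧ m (target T L) = some (safeArm T L)) ∧
    ((rival T L (t / L) : ℕ) ∉ S →
      m (rival T L (t / L)) = some (safeArm T L) ∧ m (target T L) = some (testArm T L)) :=
  ⟨fun h => hm.eq_of_two safeArm_ne_testArm.symm (rival_ne_target _) rfl (Finset.pair_comm _ _) rfl
    rfl (prefers_info t _) (mean_safeArm_lt h),
   fun h => hm.eq_of_two safeArm_ne_testArm (rival_ne_target _) rfl rfl rfl rfl (prefers_info t _)
    (mean_testArm_lt h)⟩

theorem isStable_playerOptimal_playerPessimal (S : Set ℕ) (t : ℕ) :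
    ((streamEnvironment T L).info t).IsStable (thresholdRewards S)
        (((streamEnvironment T L).info t).playerOptimal (thresholdRewards S)) ∧
      ((streamEnvironment T L).info t).IsStable (thresholdRewards S)
        (((streamEnvironment T L).info t).playerPessimal (thresholdRewards S)) := by
  by_cases h : (rival T L (t / L) : ℕ) ∈ S
  · exact RoundInfo.isStable_playerOptimal_playerPessimal_of_two safeArm_ne_testArm.symm
      (rival_ne_target (t / L)) rfl (Finset.pair_comm _ _) rfl rfl (prefers_info t _)
      (mean_safeArm_lt h)
  · exact RoundInfo.isStable_playerOptimal_playerPessimal_of_two safeArm_ne_testArm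
      (rival_ne_target (t / L)) rfl rfl rfl rfl (prefers_info t _) (mean_testArm_lt h)

theorem pessimalRegret_eq_optimalRegret (S : Set ℕ) (π : Policy)
    (i : Fin (streamEnvironment T L).N) :
    (streamEnvironment T L).pessimalRegret (thresholdRewards S) π i =
      (streamEnvironment T L).optimalRegret (thresholdRewards S) π i := by
  unfold Environment.pessimalRegret Environment.optimalRegret
  refine Finset.sum_congr rfl fun t ht => ?_
  have hi := (Finset.mem_filter.1 ht).2
  rw [players_info, Finset.mem_insert, Finset.mem_singleton] at hi
  obtain ⟨ho, hp⟩ := isStable_playerOptimal_playerPessimal (T := T) (L := L) S t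
  have ho' := eq_of_isStable ho
  have hp' := eq_of_isStable hp
  have : ((streamEnvironment T L).info t).playerPessimal (thresholdRewards S) i =
      ((streamEnvironment T L).info t).playerOptimal (thresholdRewards S) i := by
    by_cases h : (rival T L (t / L) : ℕ) ∈ S
    · rcases hi with rfl | rfl
      · exact (hp'.1 h).2.trans (ho'.1 h).2.symm
      · exact (hp'.1 h).1.trans (ho'.1 h).1.symm
    · rcases hi with rfl | rfl
      · exact (hp'.2 h).2.trans (ho'.2 h).2.symm
      · exact (hp'.2 h).1.trans (ho'.2 h).1.symm
  rw [this]

theorem numRounds_target (T L : ℕ) :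
    (streamEnvironment T L).numRounds (target T L) = T := by
  unfold Environment.numRounds Environment.rounds
  simp [players_info]

theorem mem_rounds_rival {b t : ℕ} (hb : b ≤ T) :
    t ∈ (streamEnvironment T L).rounds (rival T L b) ↔ t < T ∧ t / L = b := by
  unfold Environment.rounds
  rw [Finset.mem_filter, Finset.mem_range]
  refine and_congr_right fun ht => ?_
  rw [players_info, Finset.mem_insert, Finset.mem_singleton,
    rival_inj hb ((Nat.div_le_self _ _).trans ht.le)]
  simp [rival_ne_target, eq_comm]

/-- The condition `b < T / L` says that the block is full, which excludes a shorter last block. -/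
theorem numRounds_rival {b : ℕ} (hL : 0 < L) (hb : b < T / L) :
    (streamEnvironment T L).numRounds (rival T L b) = L := by
  unfold Environment.numRounds
  have : (streamEnvironment T L).rounds (rival T L b) = Finset.Ico (b * L) (b * L + L) := by
    ext t
    rw [mem_rounds_rival (hb.le.trans (Nat.div_le_self _ _)), Finset.mem_Ico,
      Nat.div_eq_iff hL]
    have h1 : (b + 1) * L ≤ T := (Nat.mul_le_mul_right L hb).trans (Nat.div_mul_le_self T L)
    have h2 : (b + 1) * L = b * L + L := by ring
    omega
  rw [this, Nat.card_Ico]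
  omega

theorem expectedMisses_le_pessimalRegret {S : Set ℕ} (π : Policy)
    (i : Fin (streamEnvironment T L).N) (hi : (i : ℕ) ∈ S)
    (hst : ∀ t ∈ (streamEnvironment T L).rounds i,
      ((streamEnvironment T L).info t).playerPessimal (thresholdRewards S) i = some (testArm T L)) :
    1 / 4 * ((streamEnvironment T L).expectedMisses (thresholdRewards S) π i
      (testArm T L)).toReal ≤
      (streamEnvironment T L).pessimalRegret (thresholdRewards S) π i := by
  refine Environment.mul_expectedMisses_le_pessimalRegret (E := streamEnvironment T L) (v := 3 / 4)
    i _ (by norm_num) ?_ (fun j hj => ?_) (by norm_num) hst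
  · rw [coe_testArm, thresholdRewards_mean_mem hi]
  · have : (j : ℕ) ≠ 1 := fun h => hj (Fin.ext (h.trans coe_testArm.symm))
    rw [thresholdRewards_mean_ne this]
    norm_num

/-- If each competitor of a full block is often matched to arm `1`, which is not its favourite, the
regret of the target is large. -/
theorem le_pessimalRegret_target {S : Set ℕ} (π : Policy) (h0 : 0 ∈ S)
    (hS : ∀ b ≤ T, competitorIndex T b ∉ S) {k : ℕ}
    (hk : ∀ b < T / L, (k : ℝ≥0∞) ≤ 2 * (streamEnvironment T L).expectedPulls
      (thresholdRewards S) π (rival T L b) (testArm T L)) :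
    ((T / L : ℕ) : ℝ) * k / 8 ≤ (streamEnvironment T L).pessimalRegret (thresholdRewards S) π
      (target T L) := by
  have hle : ∀ b < T / L, b ≤ T := fun b hb => hb.le.trans (Nat.div_le_self _ _)
  refine le_trans ?_ (expectedMisses_le_pessimalRegret π (target T L) h0 fun t ht => ?_)
  -- The competitors of full blocks are distinct, so their pulls add up. The `8` is the gap `1/4`
  -- times the `1/2` in the hypothesis on pulls.
  · set B : Finset (Fin (streamEnvironment T L).N) := (Finset.range (T / L)).image (rival T L) with hB
    have h1 := Environment.sum_expectedPulls_le_expectedMisses (E := streamEnvironment T L)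
      (μ := thresholdRewards S) (π := π) (target T L)
      (testArm T L) B ?_ (fun t _ => Finset.mem_insert_self _ _)
      (fun t _ => ⟨Finset.mem_insert_of_mem (Finset.mem_singleton_self _), rfl⟩)
    · have h2 : ((T / L : ℕ) : ℝ≥0∞) * k ≤ 2 * (streamEnvironment T L).expectedMisses
          (thresholdRewards S) π (target T L) (testArm T L) := by
        refine le_trans ?_ (mul_le_mul_right h1 2)
        rw [hB, Finset.sum_image, Finset.mul_sum]
        · calc ((T / L : ℕ) : ℝ≥0∞) * k = ∑ b ∈ Finset.range (T / L), (k : ℝ≥0∞) := by simp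
            _ ≤ _ := Finset.sum_le_sum fun b hb => hk b (Finset.mem_range.1 hb)
        · intro b hb b' hb' h
          simp only [Finset.coe_range, Set.mem_Iio] at hb hb'
          exact (rival_inj (hle b hb) (hle b' hb')).1 h
      have h3 := ENNReal.toReal_mono (ENNReal.mul_ne_top ENNReal.ofNat_ne_top
        (Environment.expectedMisses_ne_top _ _)) h2
      simp only [ENNReal.toReal_mul, ENNReal.toReal_natCast, ENNReal.toReal_ofNat] at h3
      linarith
    · simp [hB, rival_ne_target]
  · have htT : t < T := Finset.mem_range.1 (Finset.mem_filter.1 ht).1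
    have hb : t / L ≤ T := (Nat.div_le_self _ _).trans htT.le
    refine ((eq_of_isStable (isStable_playerOptimal_playerPessimal S t).2).2 ?_).2
    rw [coe_rival_of_le hb]
    exact hS _ hb

/-- If the competitor of a full block is rarely matched to arm `1` when this is not its favourite,
its regret is large when arm `1` is its favourite. -/
theorem le_pessimalRegret_rival {S S' : Set ℕ} (π : Policy) (h0 : 0 ∈ S) (h0' : 0 ∈ S')
    (hS : ∀ b ≤ T, competitorIndex T b ∉ S) {b : ℕ} (hL : 0 < L) (hb : b < T / L)
    (hS' : ∀ b' ≤ T, competitorIndex T b' ∈ S' ↔ b' = b) {k : ℕ} (hk : 0 < k)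
    (hpulls : 2 * (streamEnvironment T L).expectedPulls
      (thresholdRewards S) π (rival T L b) (testArm T L) ≤ k) :
    ((L - k : ℕ) : ℝ) / (8 * 3 ^ k) ≤
      (streamEnvironment T L).pessimalRegret (thresholdRewards S') π (rival T L b) := by
  have hbT : b ≤ T := hb.le.trans (Nat.div_le_self _ _)
  have hmem' : (rival T L b : ℕ) ∈ S' := by rw [coe_rival_of_le hbT, hS' b hbT]
  have hmem : (rival T L b : ℕ) ∉ S := by
    rw [coe_rival_of_le hbT]
    exact hS b hbT
  refine le_trans ?_ (expectedMisses_le_pessimalRegret π _ hmem' fun t ht => ?_)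
  -- The ratio is worst for reward `0`: `1 - 1/4 = 3 * (1 - 3/4)`, whence `C = 3`.
  · have h1 := Environment.le_expectedMisses (E := streamEnvironment T L)
      (μ := thresholdRewards S) (μ' := thresholdRewards S') (π := π) (rival T L b)
      (testArm T L) (C := 3) (by norm_num) ?_ ?_ ?_ hk hpulls
    · rw [numRounds_rival hL hb] at h1
      have h3 := ENNReal.toReal_mono (ENNReal.mul_ne_top (ENNReal.mul_ne_top ENNReal.ofNat_ne_top (by finiteness))
        (Environment.expectedMisses_ne_top _ _)) h1
      simp only [ENNReal.toReal_mul, ENNReal.toReal_natCast, ENNReal.toReal_ofNat,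
        ENNReal.toReal_pow, Nat.cast_ofNat] at h3
      rw [div_le_iff₀ (by positivity)]
      linarith
    · intro t i hi j _ hij
      by_cases hj : (j : ℕ) = 1
      · have hj' : j = testArm T L := Fin.ext (hj.trans coe_testArm.symm)
        have hib : i ≠ rival T L b := by
          rcases hij with h | h
          · exact h
          · exact absurd hj' h
        refine thresholdRewards_mean_congr ?_ _
        rw [players_info, Finset.mem_insert, Finset.mem_singleton] at hi
        rcases hi with rfl | rfl
        · exact iff_of_true h0 h0'
        · have hmin : min (t / L) T ≤ T := min_le_right _ _
          refine iff_of_false (hS _ hmin) ?_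
          change competitorIndex T (min (t / L) T) ∉ S'
          rw [hS' _ hmin]
          rintro hc
          refine hib (Fin.ext ?_)
          rw [coe_rival_of_le hbT, ← hc]
          rfl
      · rw [thresholdRewards_mean_ne hj, thresholdRewards_mean_ne hj]
    · have e1 := thresholdRewards_mean_notMem hmem
      have e2 := thresholdRewards_mean_mem hmem'
      rw [coe_testArm, e1, e2]
      norm_num
    · have e1 := thresholdRewards_mean_notMem hmem
      have e2 := thresholdRewards_mean_mem hmem'
      rw [coe_testArm, e1, e2]
      norm_num
  · have h := (mem_rounds_rival hbT).1 ht
    have := ((eq_of_isStable (isStable_playerOptimal_playerPessimal (T := T) (L := L) S' t).2).1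
      (by rw [h.2]; exact hmem')).1
    rwa [h.2] at this

/-- Only the target and the competitors of horizon `T` are ever observed, so changes of `S` made for
other horizons are invisible. -/
theorem expectedPulls_congr {S S' : Set ℕ} (π : Policy) (h0 : 0 ∈ S ↔ 0 ∈ S')
    (hS : ∀ b ≤ T, competitorIndex T b ∈ S ↔ competitorIndex T b ∈ S')
    (i : Fin (streamEnvironment T L).N) (j : Fin (streamEnvironment T L).K) :
    (streamEnvironment T L).expectedPulls (thresholdRewards S) π i j =
      (streamEnvironment T L).expectedPulls (thresholdRewards S') π i j := by
  unfold Environment.expectedPulls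
  rw [Environment.historyLaw_congr]
  intro t i hi j _
  refine thresholdRewards_mean_congr ?_ _
  rw [players_info, Finset.mem_insert, Finset.mem_singleton] at hi
  rcases hi with rfl | rfl
  · exact h0
  · exact hS _ (min_le_right _ _)

/-- Some collection of rewards makes, for every horizon, the target or a competitor suffer. -/
theorem exists_rewards (π : Policy) (L k : ℕ → ℕ) :
    ∃ S : Set ℕ, ∀ T, 0 < L T → 0 < k T → ∃ i : Fin (streamEnvironment T (L T)).N,
      ((streamEnvironment T (L T)).numRounds i = T ∧ ((T / L T : ℕ) : ℝ) * k T / 8 ≤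
        (streamEnvironment T (L T)).pessimalRegret (thresholdRewards S) π i) ∨
      ((streamEnvironment T (L T)).numRounds i = L T ∧ ((L T - k T : ℕ) : ℝ) / (8 * 3 ^ k T) ≤
        (streamEnvironment T (L T)).pessimalRegret (thresholdRewards S) π i) := by
  -- Badness is tested under the baseline `{0}`, so that defining `S` from it is not circular.
  let bad : ℕ → ℕ → Prop := fun T b => b < T / L T ∧ 2 * (streamEnvironment T (L T)).expectedPulls
      (thresholdRewards {0}) π (rival T (L T) b) (testArm T (L T)) ≤ k T
  have hex : ∀ T, ∃ b, (∃ b', bad T b') → bad T b := fun T => by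
    by_cases h : ∃ b', bad T b'
    · exact h.imp fun b hb _ => hb
    · exact ⟨0, fun h' => absurd h' h⟩
  choose β hβ using hex
  let S : Set ℕ := {x | x = 0 ∨ ∃ T, bad T (β T) ∧ x = competitorIndex T (β T)}
  have h0 : 0 ∈ S := Or.inl rfl
  have h0' : ∀ T b, competitorIndex T b ∉ ({0} : Set ℕ) := fun T b => by simp [competitorIndex]
  have hS : ∀ T b, competitorIndex T b ∈ S ↔ bad T (β T) ∧ b = β T := by
    intro T b
    refine ⟨?_, fun h => Or.inr ⟨T, h.1, by rw [h.2]⟩⟩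
    rintro (h | ⟨T', h, h'⟩)
    · simp [competitorIndex] at h
    · obtain ⟨rfl, rfl⟩ := competitorIndex_inj.1 h'
      exact ⟨h, rfl⟩
  refine ⟨S, fun T hL hk => ?_⟩
  by_cases hbad : bad T (β T)
  · refine ⟨rival T (L T) (β T), Or.inr ⟨numRounds_rival hL hbad.1, ?_⟩⟩
    exact le_pessimalRegret_rival (S := {0}) π rfl h0 (fun b _ => h0' T b) hL hbad.1
      (fun b _ => by simp [hS, hbad]) hk hbad.2
  · refine ⟨target T (L T), Or.inl ⟨numRounds_target T (L T), ?_⟩⟩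
    -- No competitor was modified at this horizon, so `S` and the baseline have the same expected
    -- pulls.
    have hnot : ∀ b, competitorIndex T b ∉ S := fun b h => hbad ((hS T b).1 h).1
    refine le_pessimalRegret_target π h0 (fun b _ => hnot b) fun b hb => ?_
    rw [expectedPulls_congr (S' := {0}) π (iff_of_true h0 rfl)
      (fun b _ => iff_of_false (hnot b) (h0' T b))]
    by_contra! hlt
    exact hbad (hβ T ⟨b, hb, hlt.le⟩)

end streamEnvironment

end SleepingBandit

namespace SleepingBandit

/-! ### Choice of the block length and of the exploration threshold. -/

section asymptotics

variable {c : ℝ}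

theorem tendsto_natLog_three : Tendsto (Nat.log 3) atTop atTop := by
  refine tendsto_atTop.2 fun b => ?_
  filter_upwards [eventually_ge_atTop (3 ^ b)] with n hn
  exact Nat.le_log_of_pow_le (by norm_num) hn

theorem two_mul_le_three_pow (k : ℕ) : 2 * k ≤ 3 ^ k := by
  induction k with
  | zero => simp
  | succ k ih =>
    have := Nat.one_le_pow k 3 (by norm_num)
    rw [pow_succ]
    rcases k with _ | k
    · simp
    · omega

/-- The length of the blocks. -/
noncomputable def blockLength (c : ℝ) (T : ℕ) : ℕ := ⌈(T : ℝ) ^ (1 - c)⌉₊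

/-- The number of informative rounds that a policy can be forced to spend on a competitor in a
block of length `L`. -/
noncomputable def explorationLength (c : ℝ) (L : ℕ) : ℕ := Nat.log 3 ⌊(L : ℝ) ^ ((1 - c) / 2)⌋₊

theorem one_le_rpow_of_one_le (hc : c < 1) {T : ℕ} (hT : 1 ≤ T) : 1 ≤ (T : ℝ) ^ (1 - c) :=
  Real.one_le_rpow (by exact_mod_cast hT) (by linarith)

theorem blockLength_le_two_mul (hc : c < 1) {T : ℕ} (hT : 1 ≤ T) :
    (blockLength c T : ℝ) ≤ 2 * (T : ℝ) ^ (1 - c) := by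
  have h1 := one_le_rpow_of_one_le hc hT
  have h2 := Nat.ceil_lt_add_one (zero_le_one.trans h1)
  unfold blockLength
  linarith

theorem blockLength_le (hc0 : 0 < c) {T : ℕ} (hT : 1 ≤ T) : blockLength c T ≤ T := by
  refine Nat.ceil_le.2 ?_
  calc (T : ℝ) ^ (1 - c) ≤ (T : ℝ) ^ (1 : ℝ) :=
        Real.rpow_le_rpow_of_exponent_le (by exact_mod_cast hT) (by linarith)
    _ = T := Real.rpow_one _

theorem blockLength_pos {T : ℕ} (hT : 1 ≤ T) : 0 < blockLength c T := by
  refine Nat.ceil_pos.2 (Real.rpow_pos_of_pos ?_ _)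
  exact_mod_cast hT

theorem isTheta_blockLength (hc : c < 1) :
    (fun T => (blockLength c T : ℝ)) =Θ[atTop] (fun T : ℕ => (T : ℝ) ^ (1 - c)) := by
  refine ⟨IsBigO.of_bound 2 ?_, IsBigO.of_bound 1 ?_⟩
  · filter_upwards [eventually_ge_atTop 1] with T hT
    rw [Real.norm_of_nonneg (by positivity), Real.norm_of_nonneg (by positivity)]
    exact blockLength_le_two_mul hc hT
  · filter_upwards with T
    rw [Real.norm_of_nonneg (by positivity), Real.norm_of_nonneg (by positivity), one_mul]
    exact Nat.le_ceil _

theorem tendsto_blockLength (hc : c < 1) : Tendsto (blockLength c) atTop atTop :=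
  tendsto_nat_ceil_atTop.comp
    ((tendsto_rpow_atTop (by linarith : 0 < 1 - c)).comp tendsto_natCast_atTop_atTop)

theorem tendsto_rpow_half (hc : c < 1) :
    Tendsto (fun L : ℕ => (L : ℝ) ^ ((1 - c) / 2)) atTop atTop :=
  (tendsto_rpow_atTop (by linarith : 0 < (1 - c) / 2)).comp tendsto_natCast_atTop_atTop

theorem tendsto_explorationLength (hc : c < 1) : Tendsto (explorationLength c) atTop atTop :=
  tendsto_natLog_three.comp (tendsto_nat_floor_atTop.comp (tendsto_rpow_half hc))

/-- Rounding costs two factors of `2`: one from the ceiling in `blockLength`, one from the integer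
quotient, which is at least `1`. -/
theorem rpow_div_four_le (hc0 : 0 < c) (hc : c < 1) {T : ℕ} (hT : 1 ≤ T) :
    (T : ℝ) ^ c / 4 ≤ ((T / blockLength c T : ℕ) : ℝ) := by
  have hL := blockLength_pos (c := c) hT
  have hd : 1 ≤ T / blockLength c T := Nat.div_pos (blockLength_le hc0 hT) hL
  have h1 : T ≤ 2 * (T / blockLength c T) * blockLength c T := by
    have := Nat.lt_div_mul_add (a := T) hL
    nlinarith
  have h2 : (T : ℝ) ≤ 2 * ((T / blockLength c T : ℕ) : ℝ) * blockLength c T := by exact_mod_cast h1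
  have h3 := blockLength_le_two_mul hc hT
  have hT0 : (0 : ℝ) < T := by exact_mod_cast hT
  have h4 : (T : ℝ) ^ c * (T : ℝ) ^ (1 - c) = T := by
    rw [← Real.rpow_add hT0, add_sub_cancel, Real.rpow_one]
  have h5 : 0 < (T : ℝ) ^ (1 - c) := Real.rpow_pos_of_pos hT0 _
  have h6 : (T : ℝ) ^ c * (T : ℝ) ^ (1 - c) ≤
      4 * ((T / blockLength c T : ℕ) : ℝ) * (T : ℝ) ^ (1 - c) := by
    rw [h4]
    calc (T : ℝ) ≤ 2 * ((T / blockLength c T : ℕ) : ℝ) * blockLength c T := h2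
      _ ≤ 2 * ((T / blockLength c T : ℕ) : ℝ) * (2 * (T : ℝ) ^ (1 - c)) :=
        mul_le_mul_of_nonneg_left h3 (by positivity)
      _ = _ := by ring
  have := le_of_mul_le_mul_right h6 h5
  linarith

/-- With `x = L^((1-c)/2)`, the bounds `3^k ≤ x` and `x * L^c * x = L` leave a spare factor `x`;
moreover `2k ≤ 3^k ≤ L` gives `L - k ≥ L/2`. -/
theorem rpow_half_mul_le (hc0 : 0 < c) (hc : c < 1) {L : ℕ} (hL : 1 ≤ L) :
    (L : ℝ) ^ ((1 - c) / 2) / 16 * (L : ℝ) ^ c ≤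
      ((L - explorationLength c L : ℕ) : ℝ) / (8 * 3 ^ explorationLength c L) := by
  set k := explorationLength c L with hk
  set x := (L : ℝ) ^ ((1 - c) / 2) with hx
  have hL1 : (1 : ℝ) ≤ L := by exact_mod_cast hL
  have hL0 : (0 : ℝ) < L := by linarith
  have hx1 : 1 ≤ x := Real.one_le_rpow hL1 (by linarith)
  have hxL : x ≤ L := by
    calc x ≤ (L : ℝ) ^ (1 : ℝ) := Real.rpow_le_rpow_of_exponent_le hL1 (by linarith)
      _ = L := Real.rpow_one _
  have h3 : (3 : ℝ) ^ k ≤ x := by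
    have h : 3 ^ k ≤ ⌊x⌋₊ := Nat.pow_log_le_self 3 (Nat.floor_pos.2 hx1).ne'
    calc (3 : ℝ) ^ k ≤ (⌊x⌋₊ : ℝ) := by exact_mod_cast h
      _ ≤ x := Nat.floor_le (by linarith)
  have h2k : 2 * (k : ℝ) ≤ L := by
    have : 2 * (k : ℝ) ≤ 3 ^ k := by exact_mod_cast two_mul_le_three_pow k
    linarith
  have hkL : k ≤ L := by
    have : (k : ℝ) ≤ L := by linarith
    exact_mod_cast this
  have hxx : x * (L : ℝ) ^ c * x = L := by
    rw [hx, ← Real.rpow_add hL0, ← Real.rpow_add hL0]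
    ring_nf
    exact Real.rpow_one _
  rw [le_div_iff₀ (by positivity), Nat.cast_sub hkL]
  calc x / 16 * (L : ℝ) ^ c * (8 * 3 ^ k) = x * (L : ℝ) ^ c * 3 ^ k / 2 := by ring
    _ ≤ x * (L : ℝ) ^ c * x / 2 := by gcongr
    _ = L / 2 := by rw [hxx]
    _ ≤ L - k := by linarith

end asymptotics

/-! ### Assembly of the two parts of the theorem. -/

theorem exists_stream_regret (π : Policy) {c : ℝ} (hc0 : 0 < c) (hc1 : c < 1) :
    ∃ (μ : Rewards) (Δ : ℝ) (L : ℕ → ℕ) (E : ∀ T : ℕ, Environment T) (i : ∀ T : ℕ, Fin (E T).N),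
      0 < Δ ∧ (∀ T, (E T).HasGap μ Δ) ∧
      (fun T => (L T : ℝ)) =Θ[atTop] (fun T : ℕ => (T : ℝ) ^ (1 - c)) ∧
      (∀ T, (E T).IsBlockStream (L T)) ∧
      Tendsto (fun T => (E T).numRounds (i T)) atTop atTop ∧
      (∀ T, (E T).pessimalRegret μ π (i T) ≤ (E T).optimalRegret μ π (i T)) ∧
      Tendsto (fun T => (E T).pessimalRegret μ π (i T) / ((E T).numRounds (i T) : ℝ) ^ c)
        atTop atTop := by
  set L := blockLength c with hLdef
  set k := fun T => explorationLength c (L T) with hkdef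
  obtain ⟨S, hS⟩ := streamEnvironment.exists_rewards π L k
  -- At the finitely many horizons where `L` or `k` vanishes, the target is an arbitrary default.
  have hS' : ∀ T, ∃ i, 0 < L T → 0 < k T → _ := fun T => by
    by_cases h : 0 < L T ∧ 0 < k T
    · exact (hS T h.1 h.2).imp fun i hi _ _ => hi
    · exact ⟨streamEnvironment.target T (L T), fun h1 h2 => absurd ⟨h1, h2⟩ h⟩
  choose i hi using hS'
  have hLtop : Tendsto L atTop atTop := tendsto_blockLength hc1
  have hktop : Tendsto k atTop atTop := (tendsto_explorationLength hc1).comp hLtop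
  refine ⟨thresholdRewards S, 1 / 4, L, fun T => streamEnvironment T (L T), i, by norm_num,
    fun T => streamEnvironment.hasGap S T _, isTheta_blockLength hc1,
    fun T => streamEnvironment.isBlockStream T _, ?_,
    fun T => (streamEnvironment.pessimalRegret_eq_optimalRegret S π (i T)).le, ?_⟩
  · refine tendsto_atTop.2 fun b => ?_
    filter_upwards [eventually_ge_atTop b, hLtop.eventually_ge_atTop b,
      hLtop.eventually_gt_atTop 0, hktop.eventually_gt_atTop 0] with T h1 h2 h3 h4
    rcases hi T h3 h4 with h | h
    · rw [h.1]
      exact h1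
    · rw [h.1]
      exact h2
  · have hx := (tendsto_rpow_half hc1).comp hLtop
    have hk' : Tendsto (fun T => (k T : ℝ)) atTop atTop :=
      tendsto_natCast_atTop_atTop.comp hktop
    refine tendsto_atTop.2 fun b => ?_
    filter_upwards [eventually_ge_atTop 1, hLtop.eventually_gt_atTop 0,
      hktop.eventually_gt_atTop 0, hk'.eventually_ge_atTop (32 * b),
      hx.eventually_ge_atTop (16 * b)] with T hT h3 h4 h5 h6
    rcases hi T h3 h4 with ⟨hn, hr⟩ | ⟨hn, hr⟩
    · have hpos : 0 < (T : ℝ) ^ c := Real.rpow_pos_of_pos (by exact_mod_cast hT) _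
      rw [hn]
      calc b ≤ k T / 32 := by linarith
        _ ≤ _ := by
          rw [le_div_iff₀ hpos]
          refine le_trans ?_ hr
          calc (k T : ℝ) / 32 * (T : ℝ) ^ c = (T : ℝ) ^ c / 4 * k T / 8 := by ring
            _ ≤ _ := by
              gcongr
              exact rpow_div_four_le hc0 hc1 hT
    · have hpos : 0 < (L T : ℝ) ^ c := Real.rpow_pos_of_pos (by exact_mod_cast h3) _
      rw [hn]
      calc b ≤ (L T : ℝ) ^ ((1 - c) / 2) / 16 := by
            simp only [Function.comp_apply] at h6
            linarith
        _ ≤ _ := by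
          rw [le_div_iff₀ hpos]
          exact (rpow_half_mul_le hc0 hc1 h3).trans hr

theorem not_eventually_le_mul_rpow {r n : ℕ → ℝ} {c : ℝ} (hn : ∀ T, 0 ≤ n T)
    (h : Tendsto (fun T => r T / n T ^ c) atTop atTop) :
    ¬ ∀ ε : ℝ, 0 < ε → ∀ᶠ T in atTop, r T ≤ ε * n T ^ c := by
  intro hle
  obtain ⟨T, h1, h2⟩ := ((hle 1 one_pos).and (h.eventually_gt_atTop 1)).exists
  exact absurd (div_le_of_le_mul₀ (Real.rpow_nonneg (hn T) c) zero_le_one h1) (not_le.2 h2)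

theorem not_isConsistent (π : Policy) {α : ℝ} (h0 : 0 ≤ α) (h1 : α < 1) : ¬ π.IsConsistent α := by
  intro hcons
  obtain ⟨μ, Δ, L, E, i, hΔ, hgap, -, -, hn, hle, htop⟩ :=
    -- The midpoint of `α` and `1` is admissible both as an exponent in (a) and in the definition of
    -- consistency.
    exists_stream_regret π (c := (1 + α) / 2) (by linarith) (by linarith)
  have hnot := not_eventually_le_mul_rpow (fun T => Nat.cast_nonneg _) htop
  rcases hcons μ Δ hΔ E hgap i hn ((1 + α) / 2) (by linarith) with h | h
  · exact hnot fun ε hε => (h ε hε).mono fun T hT => (hle T).trans hT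
  · exact hnot h

end SleepingBandit

theorem theorem1 (π : Policy) :
    (∀ c : ℝ, 0 < c → c < 1 →
      ∃ (μ : Rewards) (Δ : ℝ) (L : ℕ → ℕ) (E : ∀ T : ℕ, Environment T) (i : ∀ T : ℕ, Fin (E T).N),
        0 < Δ ∧ (∀ T, (E T).HasGap μ Δ) ∧
        (fun T => (L T : ℝ)) =Θ[atTop] (fun T : ℕ => (T : ℝ) ^ (1 - c)) ∧
        (∀ T, (E T).IsBlockStream (L T)) ∧
        Tendsto (fun T => (E T).numRounds (i T)) atTop atTop ∧
        (∀ T, (E T).pessimalRegret μ π (i T) ≤ (E T).optimalRegret μ π (i T)) ∧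
        Tendsto (fun T => (E T).pessimalRegret μ π (i T) / ((E T).numRounds (i T) : ℝ) ^ c)
          atTop atTop) ∧
    ∀ α : ℝ, 0 ≤ α → α < 1 → ¬ π.IsConsistent α :=
  ⟨fun _ hc0 hc1 => exists_stream_regret π hc0 hc1, fun _ h0 h1 => not_isConsistent π h0 h1⟩
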